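/- Let $E$ be a Dedekind complete (real) Banach lattice with property (b), i.e. every subset of $E$ that is order bounded in the order bidual $E^{\sim\sim}$ is order bounded in $E$, and let $F \neq \{0\}$ be a (real) Banach lattice. A linear operator $S:V\to W$ between normed lattices is called order-to-norm continuous if $\|Sx_\alpha\|\to 0$ for every net $(x_\alpha)$ in $V$ that order converges to $0$ (that is, for which there is a net $(y_\alpha)$ with the same index set, $y_\alpha\downarrow 0$, and $|x_\alpha|\le y_\alpha$ for all sufficiently large $\alpha$). Then the following statements are equivalent. 1. Every continuous linear operator $T:E\to F$ is order-to-norm continuous. 2. Every continuous linear operator $T:E\to F$ whose adjoint $T':F'\to E'$ is order-to-norm continuous is itself order-to-norm continuous. (Here the norm duals carry the order $f\le g \iff f(x)\le g(x)$ for all $x\ge 0$.) 3. $E$ is a KB-space, i.e. every increasing norm bounded sequence in $E^+$ is norm convergent. -/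

import Mathlib

open Filter Topology Set

universe u v

/-- Order convergence `x_α → l` of a net in an ordered vector space: there is a net `y_α ↓ 0`,
on the same index set, with `|x_α - l| ≤ y_α` for all large `α`. In a vector lattice
`-y ≤ z ∧ z ≤ y` is the same as `|z| ≤ y`. -/
def OrderConv {V : Type*} [AddCommGroup V] [PartialOrder V] {A : Type*} [Preorder A]
    (x : A → V) (l : V) : Prop :=
  ∃ y : A → V, Antitone y ∧ IsGLB (range y) 0 ∧
    ∃ a₀ : A, ∀ a, a₀ ≤ a → -y a ≤ x a - l ∧ x a - l ≤ y a

/-- `T` is order-to-norm continuous: `x_α → 0` in order implies `T x_α → 0` in norm, for every net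
`x_α` in `V`. (Nets indexed by types in the universe of `V` suffice: a net witnessing failure can
be re-indexed by a directed subset of `V × V`.) -/
def OrderToNormContinuous {V : Type u} {W : Type v} [AddCommGroup V] [PartialOrder V]
    [NormedAddCommGroup W] (T : V → W) : Prop :=
  ∀ (A : Type u) [Preorder A] [IsDirectedOrder A] [Nonempty A] (x : A → V),
    OrderConv x 0 → Tendsto (fun a => T (x a)) atTop (𝓝 0)

/-- Every nonempty subset that is bounded above has a supremum. -/
def IsDedekindComplete (V : Type*) [PartialOrder V] : Prop :=
  ∀ S : Set V, S.Nonempty → BddAbove S → ∃ s, IsLUB S s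

/-- A KB-space (for `V` a Banach lattice): every increasing norm bounded sequence of positive
elements is norm convergent. -/
def IsKBSpace (V : Type*) [NormedAddCommGroup V] [PartialOrder V] : Prop :=
  ∀ x : ℕ → V, (∀ n, 0 ≤ x n) → Monotone x → (∃ C : ℝ, ∀ n, ‖x n‖ ≤ C) →
    ∃ l, Tendsto x atTop (𝓝 l)

/-- The linear functionals on `V` that are bounded on every order interval. -/
def ordBddFunctionals (V : Type*) [AddCommGroup V] [Module ℝ V] [Preorder V] :
    Submodule ℝ (V →ₗ[ℝ] ℝ) where
  carrier := {f | ∀ a b : V, ∃ C : ℝ, ∀ x ∈ Icc a b, |f x| ≤ C}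
  zero_mem' := fun _ _ => ⟨0, by simp⟩
  add_mem' := by
    intro f g hf hg a b
    obtain ⟨C, hC⟩ := hf a b
    obtain ⟨D, hD⟩ := hg a b
    exact ⟨C + D, fun x hx => (abs_add_le _ _).trans (add_le_add (hC x hx) (hD x hx))⟩
  smul_mem' := by
    intro c f hf a b
    obtain ⟨C, hC⟩ := hf a b
    refine ⟨|c| * C, fun x hx => ?_⟩
    simpa [abs_mul] using mul_le_mul_of_nonneg_left (hC x hx) (abs_nonneg c)

/-- The order dual `V~`: the vector space of order bounded linear functionals. -/
def OrdDual (V : Type*) [AddCommGroup V] [Module ℝ V] [Preorder V] : Type _ :=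
  ordBddFunctionals V

instance OrdDual.instAddCommGroup (V : Type*) [AddCommGroup V] [Module ℝ V] [Preorder V] :
    AddCommGroup (OrdDual V) :=
  inferInstanceAs (AddCommGroup (ordBddFunctionals V))

instance OrdDual.instModule (V : Type*) [AddCommGroup V] [Module ℝ V] [Preorder V] :
    Module ℝ (OrdDual V) :=
  inferInstanceAs (Module ℝ (ordBddFunctionals V))

/-- The order of the order dual: `f ≤ g` iff `f x ≤ g x` for all `x ≥ 0`. -/
instance OrdDual.instPreorder (V : Type*) [AddCommGroup V] [Module ℝ V] [Preorder V] :
    Preorder (OrdDual V) where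
  le f g := ∀ x : V, 0 ≤ x → f.1 x ≤ g.1 x
  le_refl _ _ _ := le_rfl
  le_trans _ _ _ hfg hgh x hx := (hfg x hx).trans (hgh x hx)

/-- The canonical map of a vector lattice into its order bidual, `a ↦ (f ↦ f a)`. -/
def toOrdBidual (E : Type*) [AddCommGroup E] [Module ℝ E] [Lattice E] [IsOrderedAddMonoid E]
    (a : E) : OrdDual (OrdDual E) :=
  ⟨(LinearMap.applyₗ a).comp (ordBddFunctionals E).subtype, by
    intro g h
    refine ⟨max |h.1 a⁺| |g.1 a⁺| + max |h.1 a⁻| |g.1 a⁻|, fun f hf => ?_⟩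
    have key : ∀ x : E, 0 ≤ x → |f.1 x| ≤ max |h.1 x| |g.1 x| := fun x hx => by
      rw [max_comm]
      exact abs_le_max_abs_abs (hf.1 x hx) (hf.2 x hx)
    have e : f.1 a = f.1 a⁺ - f.1 a⁻ := by rw [← map_sub, posPart_sub_negPart]
    change |f.1 a| ≤ _
    rw [e]
    exact (abs_sub _ _).trans (add_le_add (key _ (posPart_nonneg a)) (key _ (negPart_nonneg a)))⟩

/-- Property (b): every subset of `E` whose canonical image in the order bidual is order bounded
there is already order bounded in `E`. -/
def HasPropertyB (E : Type*) [AddCommGroup E] [Module ℝ E] [Lattice E] [IsOrderedAddMonoid E] :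
    Prop :=
  ∀ S : Set E, (∃ φ ψ : OrdDual (OrdDual E), toOrdBidual E '' S ⊆ Icc φ ψ) →
    ∃ a b : E, S ⊆ Icc a b

/-- The order of the norm dual of a normed lattice: `f ≤ g` iff `f x ≤ g x` for all `x ≥ 0`. -/
instance StrongDual.instPartialOrderOfLattice (F : Type*) [NormedAddCommGroup F]
    [NormedSpace ℝ F] [Lattice F] [IsOrderedAddMonoid F] : PartialOrder (StrongDual ℝ F) where
  le f g := ∀ x : F, 0 ≤ x → f x ≤ g x
  le_refl _ _ _ := le_rfl
  le_trans _ _ _ hfg hgh x hx := (hfg x hx).trans (hgh x hx)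
  le_antisymm f g hfg hgf := by
    ext x
    rw [← posPart_sub_negPart x, map_sub, map_sub,
      le_antisymm (hfg _ (posPart_nonneg x)) (hgf _ (posPart_nonneg x)),
      le_antisymm (hfg _ (negPart_nonneg x)) (hgf _ (negPart_nonneg x))]

/-- The adjoint `T' : F' → E'`, `T' g = g ∘ T`. -/
noncomputable def adjointOp {E F : Type*} [NormedAddCommGroup E] [NormedSpace ℝ E]
    [NormedAddCommGroup F] [NormedSpace ℝ F] (T : E →L[ℝ] F) :
    StrongDual ℝ F →L[ℝ] StrongDual ℝ E :=
  ContinuousLinearMap.precomp ℝ T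

/-! The substance is 2 → 3, tested on rank-one operators `x ↦ f x • y` with `y = |w| ≠ 0`. The
adjoint `g ↦ g y • f` is order-to-norm continuous for every `f`, because order convergence in the
norm dual forces pointwise convergence on positive vectors. So 2 makes every continuous functional
on `E` order continuous. Given a norm bounded increasing positive sequence, property (b) bounds it
above and Dedekind completeness gives a supremum `l`. Order continuity of functionals yields weak
convergence to `l`, and Mazur's argument combined with monotonicity turns this into norm
convergence. For 3 → 1, a net decreasing to `0` in a KB-space is norm Cauchy, since otherwise some
sequence extracted from it violates the KB property. Hence order null nets are already norm null,
before `T` is applied. -/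

section NormedLattice

variable {E : Type*} [NormedAddCommGroup E] [Lattice E] [IsOrderedAddMonoid E] [HasSolidNorm E]

/-- In a normed lattice the norm is monotone on the positive cone. -/
theorem norm_le_norm_of_nonneg_of_le {x y : E} (hx : 0 ≤ x) (hxy : x ≤ y) : ‖x‖ ≤ ‖y‖ :=
  norm_le_norm_of_abs_le_abs (by rwa [abs_of_nonneg hx, abs_of_nonneg (hx.trans hxy)])

/-- In a KB-space, a decreasing net with infimum `0` tends to `0` in norm. -/
theorem IsKBSpace.tendsto_zero_of_antitone [CompleteSpace E] (hKB : IsKBSpace E) {A : Type*}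
    [Preorder A] [IsDirectedOrder A] [Nonempty A] {y : A → E} (hy : Antitone y)
    (hglb : IsGLB (range y) 0) : Tendsto y atTop (𝓝 0) := by
  have hpos : ∀ a, 0 ≤ y a := fun a => hglb.1 (mem_range_self a)
  have key : ∀ ε > 0, ∃ a, ∀ b, a ≤ b → ‖y a - y b‖ ≤ ε := by
    intro ε hε
    by_contra! hcon
    choose g hg hgε using hcon
    -- Iterating `g` gives an increasing sequence of indices whose consecutive gaps all exceed `ε`;
    -- the KB property applied to `y (a 0) - y (a n)` forces those gaps to `0`.
    let a : ℕ → A := fun n => g^[n] (Classical.arbitrary A)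
    have ha : ∀ n, a (n + 1) = g (a n) := fun n => Function.iterate_succ_apply' _ _ _
    have hmono : Monotone a := monotone_nat_of_le_succ fun n => by
      rw [ha]; exact hg _
    obtain ⟨l, hl⟩ := hKB (fun n => y (a 0) - y (a n))
      (fun n => sub_nonneg.2 (hy (hmono (Nat.zero_le n))))
      (fun m n hmn => sub_le_sub_left (hy (hmono hmn)) _)
      ⟨‖y (a 0)‖, fun n => norm_le_norm_of_nonneg_of_le
        (sub_nonneg.2 (hy (hmono (Nat.zero_le n)))) (sub_le_self _ (hpos _))⟩
    have hdiff := ((tendsto_add_atTop_iff_nat 1).2 hl).sub hl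
    rw [sub_self] at hdiff
    obtain ⟨n, hn⟩ := (hdiff.norm.eventually_lt_const (by simpa using hε)).exists
    rw [sub_sub_sub_cancel_left, ha] at hn
    exact (hgε (a n)).not_gt hn
  have hcauchy : Cauchy (map y atTop) := by
    refine Metric.cauchy_iff.2 ⟨inferInstance, fun ε hε => ?_⟩
    obtain ⟨a, ha⟩ := key (ε / 3) (by positivity)
    refine ⟨y '' Ici a, image_mem_map (mem_atTop a), ?_⟩
    rintro _ ⟨b, hb, rfl⟩ _ ⟨c, hc, rfl⟩
    have hb' := ha b hb
    have hc' := ha c hc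
    rw [← dist_eq_norm] at hb' hc'
    have := dist_triangle_left (y b) (y c) (y a)
    linarith
  obtain ⟨l, hl⟩ := CompleteSpace.complete hcauchy
  rwa [← (isGLB_of_tendsto_atTop hy hl).unique hglb]

/-- In a KB-space, order convergence to `0` implies norm convergence to `0`. -/
theorem IsKBSpace.tendsto_zero_of_orderConv [CompleteSpace E] (hKB : IsKBSpace E) {A : Type*}
    [Preorder A] [IsDirectedOrder A] [Nonempty A] {x : A → E} (hx : OrderConv x 0) :
    Tendsto x atTop (𝓝 0) := by
  obtain ⟨y, hy, hglb, a₀, h⟩ := hx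
  refine squeeze_zero_norm' ?_ (tendsto_zero_iff_norm_tendsto_zero.1
    (hKB.tendsto_zero_of_antitone hy hglb))
  filter_upwards [eventually_ge_atTop a₀] with a ha
  obtain ⟨h₁, h₂⟩ := h a ha
  rw [sub_zero] at h₁ h₂
  refine norm_le_norm_of_abs_le_abs ((abs_le'.2 ⟨h₂, neg_le.1 h₁⟩).trans (le_abs_self _))

end NormedLattice

section BanachLattice

variable {E : Type*} [NormedAddCommGroup E] [NormedSpace ℝ E] [Lattice E] [IsOrderedAddMonoid E]
  [HasSolidNorm E]

/-- A decreasing net in the norm dual with infimum `0` tends to `0` pointwise. -/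
theorem StrongDual.tendsto_apply_of_antitone {A : Type*} [Preorder A] [IsDirectedOrder A]
    [Nonempty A] {h : A → StrongDual ℝ E} (hanti : Antitone h) (hglb : IsGLB (range h) 0)
    {y : E} (hy : 0 ≤ y) : Tendsto (fun a => h a y) atTop (𝓝 0) := by
  have hpos : ∀ a, ∀ x : E, 0 ≤ x → 0 ≤ h a x := fun a => hglb.1 (mem_range_self a)
  have hlim : ∀ x : E, 0 ≤ x → ∃ L, Tendsto (fun a => h a x) atTop (𝓝 L) := fun x hx =>
    ⟨_, tendsto_atTop_ciInf (fun a b hab => hanti hab x hx)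
      ⟨0, by rintro _ ⟨a, rfl⟩; exact hpos a x hx⟩⟩
  have hlim' : ∀ x : E, ∃ L, Tendsto (fun a => h a x) atTop (𝓝 L) := fun x => by
    obtain ⟨L, hL⟩ := hlim _ (posPart_nonneg x)
    obtain ⟨M, hM⟩ := hlim _ (negPart_nonneg x)
    refine ⟨L - M, (hL.sub hM).congr fun a => ?_⟩
    rw [← map_sub, posPart_sub_negPart]
  choose ℓ hℓ using hlim'
  let a₀ : A := Classical.arbitrary A
  -- The pointwise limit is itself a continuous functional, so it competes as a lower bound of the
  -- net and must be `≤ 0`.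
  let L : StrongDual ℝ E := LinearMap.mkContinuous
    { toFun := ℓ
      map_add' := fun x z => tendsto_nhds_unique (hℓ _) (by simpa using (hℓ x).add (hℓ z))
      map_smul' := fun c x => tendsto_nhds_unique (hℓ _)
        (by simpa using (hℓ x).const_mul c) } ‖h a₀‖ (by
      intro x
      refine le_of_tendsto (hℓ x).norm ?_
      filter_upwards [eventually_ge_atTop a₀] with a ha
      have h₁ : |h a x| ≤ h a |x| := abs_le'.2 ⟨by
          simpa using hpos a _ (sub_nonneg.2 (le_abs_self x)), by
          simpa [neg_le_iff_add_nonneg] using hpos a _ (sub_nonneg.2 (neg_le_abs x))⟩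
      calc |h a x| ≤ h a |x| := h₁
        _ ≤ h a₀ |x| := hanti ha _ (abs_nonneg x)
        _ ≤ ‖h a₀‖ * ‖|x|‖ := (le_abs_self _).trans ((h a₀).le_opNorm _)
        _ = ‖h a₀‖ * ‖x‖ := by rw [norm_abs_eq_norm])
  have hL : L ≤ 0 := hglb.2 (by
    rintro _ ⟨a, rfl⟩ x hx
    exact Antitone.le_of_tendsto (fun b c hbc => hanti hbc x hx) (hℓ x) a)
  have h0 : ℓ y = 0 := le_antisymm (hL y hy) (ge_of_tendsto' (hℓ y) fun a => hpos a y hy)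
  exact h0 ▸ hℓ y

/-- An order convergent net in the norm dual converges pointwise on positive vectors. -/
theorem StrongDual.tendsto_apply_of_orderConv {A : Type*} [Preorder A] [IsDirectedOrder A]
    [Nonempty A] {g : A → StrongDual ℝ E} (hg : OrderConv g 0) {y : E} (hy : 0 ≤ y) :
    Tendsto (fun a => g a y) atTop (𝓝 0) := by
  obtain ⟨h, hanti, hglb, a₀, hgh⟩ := hg
  refine squeeze_zero_norm' ?_ (tendsto_apply_of_antitone hanti hglb hy)
  filter_upwards [eventually_ge_atTop a₀] with a ha
  have := hgh a ha
  rw [sub_zero] at this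
  exact abs_le.2 ⟨this.1 y hy, this.2 y hy⟩

/-- The adjoint of a rank-one operator `x ↦ f x • y` with `0 ≤ y` is order-to-norm continuous. -/
theorem orderToNormContinuous_adjointOp_smulRight {V : Type*} [NormedAddCommGroup V]
    [NormedSpace ℝ V] (f : StrongDual ℝ V) {y : E} (hy : 0 ≤ y) :
    OrderToNormContinuous (adjointOp (f.smulRight y)) := by
  intro A _ _ _ g hg
  have key : ∀ a, adjointOp (f.smulRight y) (g a) = g a y • f := fun a => by
    ext x
    simp [adjointOp, mul_comm]
  simp only [key]
  simpa using (StrongDual.tendsto_apply_of_orderConv hg hy).smul_const f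

/-- An order bounded linear functional on a Banach lattice is norm bounded. -/
theorem ordBddFunctionals.exists_bound [CompleteSpace E] (f : ordBddFunctionals E) :
    ∃ C : ℝ, ∀ x, |f.1 x| ≤ C * ‖x‖ := by
  by_contra! hcon
  -- The `|z n|` are summable, so one order interval contains every `z n`, yet `f` is unbounded on
  -- them.
  have hsmall : ∀ n : ℕ, ∃ z : E, ‖z‖ ≤ (1 / 2 : ℝ) ^ n ∧ (n : ℝ) < |f.1 z| := fun n => by
    obtain ⟨x, hx⟩ := hcon (n * 2 ^ n)
    have hx0 : x ≠ 0 := by rintro rfl; simp at hx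
    have hn : 0 < ‖x‖ := norm_pos_iff.2 hx0
    have hr : 0 < (1 / 2 : ℝ) ^ n / ‖x‖ := by positivity
    refine ⟨((1 / 2 : ℝ) ^ n / ‖x‖) • x, ?_, ?_⟩
    · rw [norm_smul, Real.norm_of_nonneg hr.le, div_mul_cancel₀ _ hn.ne']
    · rw [map_smul, smul_eq_mul, abs_mul, abs_of_pos hr]
      calc (n : ℝ) = ((1 / 2 : ℝ) ^ n / ‖x‖) * (n * 2 ^ n * ‖x‖) := by
            rw [one_div, inv_pow]
            field_simp
        _ < _ := by gcongr
  choose z hz hfz using hsmall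
  have hsum : Summable fun n => |z n| := by
    refine Summable.of_norm_bounded (g := fun n => (1 / 2 : ℝ) ^ n)
      (summable_geometric_of_lt_one (by norm_num) (by norm_num)) fun n => ?_
    rw [norm_abs_eq_norm]
    exact hz n
  have hle : ∀ n, |z n| ≤ ∑' k, |z k| := fun n => hsum.le_tsum n fun k _ => abs_nonneg _
  obtain ⟨C, hC⟩ := f.2 (-∑' k, |z k|) (∑' k, |z k|)
  obtain ⟨n, hn⟩ := exists_nat_gt C
  exact absurd (hC (z n) (mem_Icc.2 ⟨neg_le.1 ((neg_le_abs _).trans (hle n)),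
    (le_abs_self _).trans (hle n)⟩)) (not_le.2 (hn.trans (hfz n)))

/-- In a Banach lattice with property (b), norm bounded increasing positive sequences are bounded
above. -/
theorem HasPropertyB.bddAbove_range [CompleteSpace E] (hb : HasPropertyB E) {x : ℕ → E}
    (hx : ∀ n, 0 ≤ x n) (hmono : Monotone x) {C : ℝ} (hC : ∀ n, ‖x n‖ ≤ C) :
    BddAbove (range x) := by
  -- `f` need not be positive, so `f (x n)` is only bounded; a limit along an ultrafilter still
  -- exists and is linear in `f`.
  have hlim : ∀ f : OrdDual E, ∃ L : ℝ,
      Tendsto (fun n => f.1 (x n)) (hyperfilter ℕ : Filter ℕ) (𝓝 L) := fun f => by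
    obtain ⟨D, hD⟩ := ordBddFunctionals.exists_bound f
    have hmem : ∀ n, f.1 (x n) ∈ Icc (-(|D| * C)) (|D| * C) := fun n => abs_le.1 <|
      (hD _).trans <| (mul_le_mul_of_nonneg_right (le_abs_self D) (norm_nonneg _)).trans <|
        mul_le_mul_of_nonneg_left (hC n) (abs_nonneg D)
    obtain ⟨L, -, hL⟩ := (isCompact_Icc (a := -(|D| * C)) (b := |D| * C)).ultrafilter_le_nhds
      ((hyperfilter ℕ).map fun n => f.1 (x n)) (by
        rw [le_principal_iff]
        exact Ultrafilter.mem_map.2 (univ_mem' hmem))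
    exact ⟨L, hL⟩
  choose L hL using hlim
  let Φ : OrdDual E →ₗ[ℝ] ℝ :=
    { toFun := L
      map_add' := fun f g => tendsto_nhds_unique (hL _) ((hL f).add (hL g))
      map_smul' := fun c f => tendsto_nhds_unique (hL _) ((hL f).const_mul c) }
  have hmonoL : ∀ f g : OrdDual E, f ≤ g → L f ≤ L g := fun f g hfg =>
    le_of_tendsto_of_tendsto' (hL f) (hL g) fun n => hfg _ (hx n)
  let φ : OrdDual (OrdDual E) := ⟨Φ, fun g h => ⟨max |L g| |L h|, fun f hf => by
    exact abs_le_max_abs_abs (hmonoL g f hf.1) (hmonoL f h hf.2)⟩⟩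
  obtain ⟨a, b, hab⟩ := hb (range x) ⟨0, φ, by
    rintro _ ⟨_, ⟨n, rfl⟩, rfl⟩
    refine ⟨fun f hf => hf (x n) (hx n), fun f hf => ge_of_tendsto (hL f) ?_⟩
    -- The ultrafilter is nonprincipal, so it contains every tail of `ℕ`.
    have : ∀ᶠ m in (hyperfilter ℕ : Filter ℕ), n ≤ m :=
      Nat.hyperfilter_le_atTop (eventually_ge_atTop n)
    filter_upwards [this] with m hm
    have h0 : 0 ≤ f.1 (x m - x n) := hf _ (sub_nonneg.2 (hmono hm))
    rw [map_sub] at h0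
    exact sub_nonneg.1 h0⟩
  exact ⟨b, fun z hz => (hab hz).2⟩

/-- An increasing sequence that converges weakly to an upper bound converges in norm. -/
theorem tendsto_of_monotone_of_weakly_tendsto [IsOrderedModule ℝ E] {x : ℕ → E} {l : E}
    (hmono : Monotone x) (hle : ∀ n, x n ≤ l)
    (hweak : ∀ f : StrongDual ℝ E, Tendsto (fun n => f (x n)) atTop (𝓝 (f l))) :
    Tendsto x atTop (𝓝 l) := by
  have hmem : l ∈ closure (convexHull ℝ (range x)) := by
    by_contra hl
    obtain ⟨f, u, hu, hul⟩ := geometric_hahn_banach_closed_point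
      (convex_convexHull ℝ (range x)).closure isClosed_closure hl
    exact hul.not_ge (le_of_tendsto' (hweak f) fun n =>
      (hu _ (subset_closure (subset_convexHull ℝ _ (mem_range_self n)))).le)
  -- By monotonicity a convex combination lies below the term of largest index used, so closeness of
  -- `c` to `l` passes to all later `x n` through `0 ≤ l - x n ≤ l - c`.
  have hdom : ∀ c ∈ convexHull ℝ (range x), ∃ N, c ≤ x N := by
    refine convexHull_min (t := {c | ∃ N, c ≤ x N}) ?_ ?_
    · rintro _ ⟨n, rfl⟩
      exact ⟨n, le_rfl⟩
    · rintro c ⟨M, hM⟩ d ⟨N, hN⟩ s t hs ht hst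
      exact ⟨max M N, (convex_Iic (𝕜 := ℝ) (x (max M N))) (hM.trans (hmono (le_max_left M N)))
        (hN.trans (hmono (le_max_right M N))) hs ht hst⟩
  refine Metric.tendsto_atTop.2 fun ε hε => ?_
  obtain ⟨c, hc, hcε⟩ := Metric.mem_closure_iff.1 hmem ε hε
  obtain ⟨N, hN⟩ := hdom c hc
  refine ⟨N, fun n hn => lt_of_le_of_lt ?_ hcε⟩
  rw [dist_comm, dist_eq_norm, dist_eq_norm]
  exact norm_le_norm_of_nonneg_of_le (sub_nonneg.2 (hle n))
    (sub_le_sub_left (hN.trans (hmono hn)) l)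

end BanachLattice

/-- A Dedekind complete Banach lattice with property (b) all of whose continuous functionals are
order continuous is a KB-space. -/
theorem isKBSpace_of_forall_orderToNormContinuous {E : Type u} [NormedAddCommGroup E]
    [NormedSpace ℝ E] [Lattice E] [IsOrderedAddMonoid E] [IsOrderedModule ℝ E] [HasSolidNorm E]
    [CompleteSpace E] (hE : IsDedekindComplete E) (hb : HasPropertyB E)
    (hcont : ∀ f : StrongDual ℝ E, OrderToNormContinuous f) : IsKBSpace E := by
  rintro x hx hmono ⟨C, hC⟩
  obtain ⟨l, hl⟩ := hE (range x) (range_nonempty x) (hb.bddAbove_range hx hmono hC)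
  have hle : ∀ n, x n ≤ l := fun n => hl.1 (mem_range_self n)
  refine ⟨l, tendsto_of_monotone_of_weakly_tendsto hmono hle fun f => ?_⟩
  -- `ULift` moves the index set `ℕ` into the universe of `E`.
  have hconv : OrderConv (fun n : ULift.{u} ℕ => l - x n.down) 0 := by
    refine ⟨_, fun m n hmn => sub_le_sub_left (hmono hmn) l, ⟨?_, fun z hz => ?_⟩, ⟨0⟩,
      fun n _ => ?_⟩
    · rintro _ ⟨n, rfl⟩
      exact sub_nonneg.2 (hle _)
    · refine (le_sub_self_iff l).1 (hl.2 ?_)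
      rintro _ ⟨n, rfl⟩
      exact le_sub_comm.1 (hz ⟨⟨n⟩, rfl⟩)
    · rw [sub_zero]
      exact ⟨(neg_nonpos.2 (sub_nonneg.2 (hle _))).trans (sub_nonneg.2 (hle _)), le_rfl⟩
  have hup : Tendsto (ULift.up.{u} : ℕ → ULift.{u} ℕ) atTop atTop :=
    tendsto_atTop.2 fun n => (eventually_ge_atTop n.down).mono fun _ h => h
  have := (hcont f _ _ hconv).comp hup
  have h' := this.const_sub (f l)
  simpa [Function.comp_def] using h'

theorem mainTheorem2
    (E : Type u) [NormedAddCommGroup E] [NormedSpace ℝ E] [Lattice E] [IsOrderedAddMonoid E]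
    [IsOrderedModule ℝ E] [HasSolidNorm E] [CompleteSpace E]
    (F : Type v) [NormedAddCommGroup F] [NormedSpace ℝ F] [Lattice F] [IsOrderedAddMonoid F]
    [IsOrderedModule ℝ F] [HasSolidNorm F] [CompleteSpace F] [Nontrivial F]
    (hE : IsDedekindComplete E) (hb : HasPropertyB E) :
    List.TFAE [
      ∀ T : E →L[ℝ] F, OrderToNormContinuous T,
      ∀ T : E →L[ℝ] F, OrderToNormContinuous (adjointOp T) → OrderToNormContinuous T,
      IsKBSpace E] := by
  tfae_have 1 → 2 := fun h T _ => h T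
  tfae_have 2 → 3 := fun h => by
    obtain ⟨w, hw⟩ := exists_ne (0 : F)
    have hy : 0 ≤ |w| := abs_nonneg w
    have hy0 : ‖|w|‖ ≠ 0 := by rwa [norm_abs_eq_norm, norm_ne_zero_iff]
    refine isKBSpace_of_forall_orderToNormContinuous hE hb fun f A _ _ _ x hx => ?_
    have := (h _ (orderToNormContinuous_adjointOp_smulRight f hy) A x hx).norm.div_const ‖|w|‖
    refine tendsto_zero_iff_norm_tendsto_zero.2 ?_
    simpa [norm_smul, mul_div_cancel_right₀, hy0] using this
  tfae_have 3 → 1 := fun hKB T A _ _ _ x hx => by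
    simpa [Function.comp_def] using (T.continuous.tendsto 0).comp (hKB.tendsto_zero_of_orderConv hx)
  tfae_finish
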